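/- For $a\in\mathbb C$ and $k\in\mathbb N_0$ let $(a)_k=a(a+1)\cdots(a+k-1)$, $(a)_0=1$. For $N\in\mathbb N_0$, $p\in\mathbb C\setminus\{0,1\}$ and every $n\in\mathbb N_0$ let $$K_n(x;p,N)=\sum_{k=0}^{n}\frac{(-n)_k(-x)_k\,(-N+k)_{n-k}}{k!}\,p^{\,n-k}$$ be the monic Krawtchouk polynomials; for $n\le N$ this is $(-N)_np^n\,{}_2F_1(-n,-x;-N;1/p)$. Let $$M_n(x;\beta,c)=\frac{c^n(\beta)_n}{(c-1)^n}\,{}_2F_1\!\left(-n,-x;\beta;1-\tfrac1c\right)$$ be the monic Meixner polynomials. For polynomials $r,q\in\mathbb C[x]$ put $\Delta r(x)=r(x+1)-r(x)$, $$\langle r,q\rangle_d=\sum_{x=0}^{N}r(x)q(x)\frac{p^x(1-p)^{N-x}}{x!\,(N-x)!},\qquad u_p(r)=\int_C r(z)\,\Gamma(-z)\Gamma(1+z)\left(\frac p{1-p}\right)^{z}dz,$$ where $C=\{-\tfrac12+ti:t\in\mathbb R\}$ is traversed upwards and the power is the principal one. We say that a sequence $(P_n)_{n\ge0}$ of polynomials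 is a monic orthogonal polynomial sequence (MOPS) characterized by a bilinear form $B$ if $P_n$ is monic of degree $n$, $B(P_m,P_n)=0$ for $m\ne n$, $B(P_n,P_n)\neq0$, and $P_n$ is the only monic polynomial $Q$ of degree $n$ with $B(Q,x^m)=0$ for all $0\le m<n$. 1. (Factorization.) For all $p\in\mathbb C\setminus\{0,1\}$, all $N\in\mathbb N_0$, all $n>N$ and all $x\in\mathbb C$, $$K_n(x;p,N)=K_{N+1}(x;p,N)\,M_{n-N-1}\!\left(x-N-1;N+2,\tfrac{p}{p-1}\right).$$ 2. (Discrete orthogonality.) For all $p\in\mathbb C\setminus\{0,1\}$, all $N\in\mathbb N_0$ and all $m\ne n$ in $\mathbb N_0$, $\langle K_m(\cdot;p,N),K_n(\cdot;p,N)\rangle_d=0$. 3. ($\Delta$-Sobolev orthogonality.) If $p\in\mathbb C\setminus\big((-\infty,0]\cup[1,\infty)\big)$, then the integral $u_p(r)$ converges absolutely for every polynomial $r$, and for every $N\in\mathbb N_0$ the sequence $(K_n(x;p,N))_{n\ge0}$ is a MOPS characterized by $$\langle r,q\rangle_S=\langle r,q\rangle_d+u_p\big(\Delta^{N+1}r\cdot\Delta^{N+1}q\big).$$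 4. (Analytic continuation in $p$.) There are linear functionals $L_p:\mathbb C[x]\to\mathbb C$, $p\in\mathbb C$, such that $p\mapsto L_p(r)$ is entire for every polynomial $r$ and $L_p=u_p$ for $p\in\mathbb C\setminus\big((-\infty,0]\cup[1,\infty)\big)$; and for all $p\in\mathbb C\setminus\{0,1\}$ and $N\in\mathbb N_0$ the sequence $(K_n(x;p,N))_{n\ge0}$ is a MOPS characterized by $\langle r,q\rangle_d+L_p\big(\Delta^{N+1}r\cdot\Delta^{N+1}q\big)$. -/

import Mathlib

open Polynomial

noncomputable section

namespace KrawtchoukSobolev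

/-- The Pochhammer symbol `(a)_k = a (a+1) ⋯ (a+k-1)`. -/
def poch (a : ℂ) (k : ℕ) : ℂ := (ascPochhammer ℂ k).eval a

/-- The polynomial `(-x)_k` in the indeterminate `x`. -/
def negPoch (k : ℕ) : ℂ[X] := (ascPochhammer ℂ k).comp (-X)

/-- The monic Krawtchouk polynomial `K_n(x;p,N) = (-N)_n p^n ₂F₁(-n,-x;-N;1/p)`, for every degree
`n`, with the quotient `(-N)_n / (-N)_k` in the `k`-th term of the sum written in its reduced form
`(-N+k)_{n-k}`, which makes sense for `n > N` too. -/
def krawtchouk (p : ℂ) (N n : ℕ) : ℂ[X] :=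
  ∑ k ∈ Finset.range (n + 1),
    C (poch (-(n : ℂ)) k * poch (-(N : ℂ) + k) (n - k) / (k.factorial : ℂ) * p ^ (n - k))
      * negPoch k

/-- The monic Meixner polynomial
`M_n(x;β,c) = c^n (β)_n / (c-1)^n ₂F₁(-n,-x;β;1-1/c)`, for `c ≠ 0, 1` and
`β ≠ 0, -1, -2, …`. -/
def meixner (β c : ℂ) (n : ℕ) : ℂ[X] :=
  C (c ^ n * poch β n / (c - 1) ^ n) *
    ∑ k ∈ Finset.range (n + 1),
      C (poch (-(n : ℂ)) k / (poch β k * (k.factorial : ℂ)) * (1 - 1 / c) ^ k) * negPoch k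

theorem poch_add (a : ℂ) (k m : ℕ) : poch a (k+m) = poch a k * poch (a + k) m := by
  simp only [poch, ← ascPochhammer_mul, Polynomial.eval_mul]
  simp

theorem poch_neg_natCast_ne_zero {k N : ℕ} (h : k ≤ N) : poch (-(N : ℂ)) k ≠ 0 := by
  intro h0
  rw [poch, ascPochhammer_eval_neg_eq_descPochhammer] at h0
  rw [descPochhammer_eval_eq_descFactorial] at h0
  simp [Nat.descFactorial_eq_zero_iff_lt] at h0
  omega

theorem hyp_eq_sum (n : ℕ) (b c y : ℂ) : ₂F₁ (-(n : ℂ)) b c y =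
    ∑ k ∈ Finset.range (n + 1), poch (-(n : ℂ)) k * poch b k / (poch c k * (k.factorial : ℂ)) * y ^ k := by
  rw [ordinaryHypergeometric_eq_tsum]
  beta_reduce
  rw [tsum_eq_sum (s := Finset.range (n+1))]
  · refine Finset.sum_congr rfl fun k _ => ?_
    simp only [poch, smul_eq_mul, div_eq_mul_inv, mul_inv]
    ring
  · intro k hk
    have : (ascPochhammer ℂ k).eval (-(n : ℂ)) = 0 := by
      rw [ascPochhammer_eval_neg_eq_descPochhammer, descPochhammer_eval_eq_descFactorial]
      simp at hk
      simp [Nat.descFactorial_eq_zero_iff_lt]; omega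
    simp [this]

/-- For `n ≤ N` the reduced definition is literally the hypergeometric one. -/
theorem eval_krawtchouk {p : ℂ} (hp : p ≠ 0) {N n : ℕ} (h : n ≤ N) (x : ℂ) :
    (krawtchouk p N n).eval x =
      poch (-(N : ℂ)) n * p ^ n * ₂F₁ (-(n : ℂ)) (-x) (-(N : ℂ)) (1 / p) := by
  rw [hyp_eq_sum, krawtchouk, Polynomial.eval_finsetSum, Finset.mul_sum]
  refine Finset.sum_congr rfl fun k hk => ?_
  obtain ⟨m, rfl⟩ := Nat.exists_eq_add_of_le (Nat.lt_succ_iff.1 (Finset.mem_range.1 hk))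
  have h1 := poch_neg_natCast_ne_zero (show k ≤ N by omega)
  rw [poch_add (-(N : ℂ))]
  simp only [negPoch, eval_mul, eval_C, eval_comp, eval_neg, eval_X, add_tsub_cancel_left]
  change _ * poch (-x) k = _
  have h2 : p ^ k * (1 / p) ^ k = 1 := by rw [← mul_pow, mul_one_div_cancel hp, one_pow]
  have h3 : (k.factorial : ℂ) ≠ 0 := by exact_mod_cast k.factorial_ne_zero
  rw [pow_add, show ∀ a b c d e f g : ℂ, a * b * (c * d) * (e / (f * g) * (1 / p) ^ k)
    = a * b * d * e / (f * g) * (c * (1 / p) ^ k) by intros; ring, h2]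
  field_simp

/-- The Meixner polynomials in terms of Mathlib's hypergeometric function. -/
theorem eval_meixner (β c : ℂ) (n : ℕ) (x : ℂ) :
    (meixner β c n).eval x =
      c ^ n * poch β n / (c - 1) ^ n * ₂F₁ (-(n : ℂ)) (-x) β (1 - 1 / c) := by
  rw [hyp_eq_sum, meixner, eval_mul, eval_C, Polynomial.eval_finsetSum]
  congr 1
  refine Finset.sum_congr rfl fun k _ => ?_
  simp only [negPoch, eval_mul, eval_C, eval_comp, eval_neg, eval_X]
  change _ * poch (-x) k = _
  ring

/-- The forward difference `Δ r (x) = r (x + 1) - r (x)` on polynomials. -/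
def delta (r : ℂ[X]) : ℂ[X] := r.comp (X + 1) - r

/-- The discrete form `∑_{x=0}^N r(x) q(x) p^x (1-p)^{N-x} / (x! (N-x)!)`. -/
def discreteForm (p : ℂ) (N : ℕ) (r q : ℂ[X]) : ℂ :=
  ∑ x ∈ Finset.range (N + 1),
    r.eval (x : ℂ) * q.eval (x : ℂ) *
      (p ^ x * (1 - p) ^ (N - x) / ((x.factorial : ℂ) * ((N - x).factorial : ℂ)))

/-- The point `-1/2 + t i` of the contour `C`. -/
def contourPt (t : ℝ) : ℂ := -1 / 2 + t * Complex.I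

/-- The weight `Γ(-z) Γ(1+z) (p/(1-p))^z` (principal branch of the power). -/
def weight (p z : ℂ) : ℂ :=
  Complex.Gamma (-z) * Complex.Gamma (1 + z) * (p / (1 - p)) ^ z

/-- The functional `r ↦ ∫_C r(z) Γ(-z) Γ(1+z) (p/(1-p))^z dz`, where `C` is the line
`-1/2 + t i` traversed upwards (so `dz = i dt`). -/
def contourFunctional (p : ℂ) (r : ℂ[X]) : ℂ :=
  ∫ t : ℝ, r.eval (contourPt t) * weight p (contourPt t) * Complex.I

/-- The set `ℂ ∖ ((-∞,0] ∪ [1,∞))`, on which the integral over `C` converges. -/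
def convergenceDomain : Set ℂ := {p | p.im ≠ 0 ∨ (0 < p.re ∧ p.re < 1)}

/-- The `Δ`-Sobolev form `⟨r,q⟩_d + u (Δ^{N+1} r · Δ^{N+1} q)` whose second part is given by the
functional `u`. -/
def sobolevForm (p : ℂ) (N : ℕ) (u : ℂ[X] → ℂ) (r q : ℂ[X]) : ℂ :=
  discreteForm p N r q + u (delta^[N + 1] r * delta^[N + 1] q)

/-- `P` is a monic orthogonal polynomial sequence for the form `B`, and each `P n` is the only
monic polynomial of degree `n` that is orthogonal to all lower powers of `x`. -/
structure IsMOPS (B : ℂ[X] → ℂ[X] → ℂ) (P : ℕ → ℂ[X]) : Prop where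
  monic : ∀ n, (P n).Monic
  natDegree_eq : ∀ n, (P n).natDegree = n
  orthogonal : ∀ m n, m ≠ n → B (P m) (P n) = 0
  regular : ∀ n, B (P n) (P n) ≠ 0
  unique : ∀ (n : ℕ) (Q : ℂ[X]), Q.Monic → Q.natDegree = n →
    (∀ m < n, B Q (X ^ m) = 0) → Q = P n

end KrawtchoukSobolev

end

noncomputable section

namespace KrawtchoukSobolev

/-! Everything specializes one family. `generalKrawtchouk a p n` has falling factorial coefficients
binom(n,k) (a+k)_{n-k} p^{n-k}; a = -N gives Krawtchouk, a = β gives Meixner with c = p/(p-1). For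
every a the family is orthogonal for `meixnerFunctional a p`, whose falling factorial moments are
(a)_k (-p)^k, with squared norm (-1)^n n! p^n (1-p)^n (a)_n.

At a = -N this functional is N! times the binomial sum, and for p ≠ 0, 1 the norm vanishes exactly
when n > N. Since Δ raises a by one, Δ^{N+1} kills the degrees n ≤ N and sends n > N to a nonzero
multiple of the member of degree n-N-1 at a = 1, where no norm vanishes. So in each degree exactly
one summand of the Sobolev form is nonzero on the diagonal.

Moving the contour across the pole at 0 gives u(r) = 2πi(1-p) r(0) - p u(Δr). This determines u on
falling factorials and shows u = 2πi(1-p) `meixnerFunctional 1 p`. The moments are polynomials in p,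
so the right side is the entire continuation.

The factorization is algebraic: for n > N the coefficients with k ≤ N vanish, and the falling
factorial of order N+1 splits off. -/

/-! ### Pochhammer symbols and the family with a general parameter -/

theorem poch_zero (a : ℂ) : poch a 0 = 1 := by simp [poch]

theorem poch_succ (a : ℂ) (k : ℕ) : poch a (k + 1) = poch a k * (a + k) := by
  simp [poch, ascPochhammer_succ_eval]

theorem poch_eq_zero_of_lt {N n : ℕ} (h : N < n) : poch (-(N : ℂ)) n = 0 := by
  rw [poch, ascPochhammer_eval_neg_eq_descPochhammer, descPochhammer_eval_eq_descFactorial]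
  simp [Nat.descFactorial_eq_zero_iff_lt.2 h]

theorem poch_neg_eq (n k : ℕ) :
    poch (-(n : ℂ)) k = (-1) ^ k * ((k.factorial : ℂ) * (n.choose k : ℂ)) := by
  rw [poch, ascPochhammer_eval_neg_eq_descPochhammer, descPochhammer_eval_eq_descFactorial,
    Nat.descFactorial_eq_factorial_mul_choose]
  push_cast; rfl

theorem poch_natCast_add_one_mul (i n : ℕ) :
    poch ((i : ℂ) + 1) n * (i.factorial : ℂ) = ((i + n).factorial : ℂ) := by
  rw [poch, ← Nat.factorial_mul_ascFactorial, ← ascPochhammer_nat_eq_ascFactorial,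
    show (i : ℂ) + 1 = ((i + 1 : ℕ) : ℂ) by push_cast; ring, Nat.cast_mul, ascPochhammer_eval_cast]
  ring

theorem cast_choose_mul_factorial_mul_factorial (k m : ℕ) :
    ((k + m).choose k : ℂ) * k.factorial * m.factorial = (k + m).factorial := by
  have := Nat.choose_mul_factorial_mul_factorial (Nat.le_add_right k m)
  rw [add_tsub_cancel_left] at this
  exact_mod_cast this

theorem negPoch_eq (k : ℕ) : negPoch k = C ((-1) ^ k) * descPochhammer ℂ k := by
  refine Polynomial.funext fun x => ?_
  simp only [negPoch, eval_comp, eval_neg, eval_X, eval_mul, eval_C]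
  exact ascPochhammer_eval_neg_eq_descPochhammer ℂ x k

/-- The monic Krawtchouk polynomials with an arbitrary complex parameter `a` in place of `-N`,
in the basis of falling factorials. -/
def generalKrawtchouk (a p : ℂ) (n : ℕ) : ℂ[X] :=
  ∑ k ∈ Finset.range (n + 1),
    C ((n.choose k : ℂ) * poch (a + k) (n - k) * p ^ (n - k)) * descPochhammer ℂ k

theorem krawtchouk_eq (p : ℂ) (N n : ℕ) : krawtchouk p N n = generalKrawtchouk (-(N : ℂ)) p n := by
  refine Finset.sum_congr rfl fun k _ => ?_
  rw [negPoch_eq, ← mul_assoc, ← C_mul, poch_neg_eq]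
  congr 2
  have h3 : (k.factorial : ℂ) ≠ 0 := by exact_mod_cast k.factorial_ne_zero
  have h2 : ((-1 : ℂ)) ^ k * (-1) ^ k = 1 := by rw [← mul_pow]; simp
  field_simp
  linear_combination (n.choose k : ℂ) * poch (-(N : ℂ) + k) (n - k) * p ^ (n - k) * h2

/-- With c = p/(p-1) one has c/(c-1) = p and 1 - 1/c = 1/p; the nonvanishing of (β)_k allows
(β)_n/(β)_k to be reduced to (β+k)_{n-k}. -/
theorem meixner_eq {β p : ℂ} (hp : p ≠ 0) (hp1 : p ≠ 1) (hβ : ∀ k, poch β k ≠ 0) (n : ℕ) :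
    meixner β (p / (p - 1)) n = generalKrawtchouk β p n := by
  rw [meixner, generalKrawtchouk, Finset.mul_sum]
  refine Finset.sum_congr rfl fun k hk => ?_
  obtain ⟨m, rfl⟩ := Nat.exists_eq_add_of_le (Nat.lt_succ_iff.1 (Finset.mem_range.1 hk))
  rw [negPoch_eq, ← mul_assoc, ← mul_assoc, ← C_mul, ← C_mul, poch_neg_eq, poch_add β]
  congr 2
  have h1 : p - 1 ≠ 0 := sub_ne_zero.2 hp1
  have hc : p / (p - 1) - 1 = 1 / (p - 1) := by field_simp; ring
  have hc' : 1 - 1 / (p / (p - 1)) = 1 / p := by field_simp; ring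
  have h3 : (k.factorial : ℂ) ≠ 0 := by exact_mod_cast k.factorial_ne_zero
  have h2 : ((-1 : ℂ)) ^ k * (-1) ^ k = 1 := by rw [← mul_pow]; simp
  have hk' := hβ k
  have h4 : (p / (p - 1)) ^ (k + m) * (poch β k * poch (β + k) m) / (p / (p - 1) - 1) ^ (k + m)
      = p ^ (k + m) * (poch β k * poch (β + k) m) := by
    rw [hc, div_pow, div_pow, one_pow]; field_simp
  rw [h4, hc', add_tsub_cancel_left, pow_add, one_div, inv_pow]
  field_simp
  linear_combination ((k + m).choose k : ℂ) * poch (β + k) m * h2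

theorem degree_descPochhammer (n : ℕ) : (descPochhammer ℂ n).degree = n := by
  rw [degree_eq_natDegree (monic_descPochhammer ℂ n).ne_zero, descPochhammer_natDegree]

theorem generalKrawtchouk_eq_add (a p : ℂ) (n : ℕ) :
    ∃ q : ℂ[X], q.degree < n ∧ generalKrawtchouk a p n = descPochhammer ℂ n + q := by
  refine ⟨∑ k ∈ Finset.range n,
    C ((n.choose k : ℂ) * poch (a + k) (n - k) * p ^ (n - k)) * descPochhammer ℂ k, ?_, ?_⟩
  · rw [← mem_degreeLT]
    refine Submodule.sum_mem _ fun k hk => ?_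
    rw [← smul_eq_C_mul]
    refine Submodule.smul_mem _ _ ?_
    rw [mem_degreeLT, degree_descPochhammer]
    exact_mod_cast Finset.mem_range.1 hk
  · rw [generalKrawtchouk, Finset.sum_range_succ, add_comm]
    simp [poch_zero]

theorem monic_generalKrawtchouk (a p : ℂ) (n : ℕ) : (generalKrawtchouk a p n).Monic := by
  obtain ⟨q, hq, h⟩ := generalKrawtchouk_eq_add a p n
  rw [h]
  exact (monic_descPochhammer ℂ n).add_of_left (by rwa [degree_descPochhammer])

theorem degree_generalKrawtchouk (a p : ℂ) (n : ℕ) : (generalKrawtchouk a p n).degree = n := by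
  obtain ⟨q, hq, h⟩ := generalKrawtchouk_eq_add a p n
  rw [h, degree_add_eq_left_of_degree_lt (by rwa [degree_descPochhammer]), degree_descPochhammer]

/-! ### Differences -/

/-- The forward difference as a linear map. -/
def deltaLin : ℂ[X] →ₗ[ℂ] ℂ[X] where
  toFun := delta
  map_add' r q := by simp [delta]; ring
  map_smul' c r := by simp [delta, smul_sub]

theorem deltaLin_apply (r : ℂ[X]) : deltaLin r = delta r := rfl

theorem deltaLin_pow_apply (n : ℕ) (r : ℂ[X]) : (deltaLin ^ n) r = delta^[n] r := by
  rw [Module.End.pow_apply]; rfl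

theorem delta_descPochhammer (k : ℕ) :
    delta (descPochhammer ℂ (k + 1)) = C ((k : ℂ) + 1) * descPochhammer ℂ k := by
  rw [delta]
  conv_lhs => rw [descPochhammer_succ_right]
  have h : (descPochhammer ℂ k * (X - (k : ℂ[X]))).comp (X + 1) = (X + 1) * descPochhammer ℂ k := by
    rw [← descPochhammer_succ_right, descPochhammer_succ_left]
    simp [comp_assoc]
  rw [h]
  simp
  ring

/-- The parameter shift comes from a + (k+1) = (a+1) + k, and the factor n from (k+1) binom(n,k+1) =
n binom(n-1,k). For n = 0 both sides vanish, so the truncated n - 1 is harmless. -/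
theorem delta_generalKrawtchouk (a p : ℂ) (n : ℕ) :
    delta (generalKrawtchouk a p n) = C (n : ℂ) * generalKrawtchouk (a + 1) p (n - 1) := by
  rw [← deltaLin_apply, generalKrawtchouk, map_sum, Finset.sum_range_succ']
  have h0 : deltaLin (C ((n.choose 0 : ℂ) * poch (a + (0 : ℕ)) (n - 0) * p ^ (n - 0)) *
      descPochhammer ℂ 0) = 0 := by
    simp [deltaLin_apply, delta]
  rw [h0, add_zero]
  rcases n with _ | n
  · simp
  rw [generalKrawtchouk, Finset.mul_sum, add_tsub_cancel_right]
  refine Finset.sum_congr rfl fun k _ => ?_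
  rw [← smul_eq_C_mul, map_smul, deltaLin_apply, delta_descPochhammer, smul_eq_C_mul, ← mul_assoc,
    ← C_mul, ← mul_assoc, ← C_mul]
  congr 2
  have h : ((n + 1 : ℕ) : ℂ) * (n.choose k : ℂ) = ((n + 1).choose (k + 1) : ℂ) * (k + 1 : ℕ) := by
    exact_mod_cast Nat.add_one_mul_choose_eq n k
  rw [Nat.succ_sub_succ, show a + ((k + 1 : ℕ) : ℂ) = a + 1 + k by push_cast; ring]
  push_cast at h ⊢
  linear_combination -poch (a + 1 + k) (n - k) * p ^ (n - k) * h

theorem delta_iterate_generalKrawtchouk (a p : ℂ) (n j : ℕ) :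
    delta^[j] (generalKrawtchouk a p n) =
      C (n.descFactorial j : ℂ) * generalKrawtchouk (a + j) p (n - j) := by
  induction j with
  | zero => simp
  | succ j ih =>
    rw [Function.iterate_succ_apply', ih, ← deltaLin_apply, ← smul_eq_C_mul, map_smul,
      deltaLin_apply, delta_generalKrawtchouk, smul_eq_C_mul, ← mul_assoc, ← C_mul,
      Nat.descFactorial_succ, Nat.sub_sub]
    push_cast
    rw [mul_comm (n.descFactorial j : ℂ), add_assoc]

/-! ### Factorization -/

theorem krawtchouk_succ_self (p : ℂ) (N : ℕ) :
    krawtchouk p N (N + 1) = descPochhammer ℂ (N + 1) := by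
  rw [krawtchouk_eq, generalKrawtchouk, Finset.sum_range_succ, Finset.sum_eq_zero]
  · simp [poch_zero]
  · intro k hk
    obtain ⟨m, rfl⟩ := Nat.exists_eq_add_of_le (Nat.lt_succ_iff.1 (Finset.mem_range.1 hk))
    rw [show -((k + m : ℕ) : ℂ) + k = -(m : ℂ) by push_cast; ring,
      poch_eq_zero_of_lt (show m < k + m + 1 - k by omega)]
    simp

/-- For k ≤ N the symbol (-N+k)_{n-k} runs through 0. In the remaining terms the falling factorial
of order N+1+k is that of order N+1 times the one of order k at x-N-1. -/
theorem krawtchouk_factorization (p : ℂ) (N s : ℕ) :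
    krawtchouk p N (N + 1 + s) = descPochhammer ℂ (N + 1) *
      (generalKrawtchouk ((N : ℂ) + 2) p s).comp (X - ((N + 1 : ℕ) : ℂ[X])) := by
  rw [krawtchouk_eq, generalKrawtchouk, show N + 1 + s + 1 = N + 1 + (s + 1) by ring,
    Finset.sum_range_add, Finset.sum_eq_zero, zero_add, generalKrawtchouk, ← coe_compRingHom_apply, map_sum,
    Finset.mul_sum]
  · refine Finset.sum_congr rfl fun k hk => ?_
    obtain ⟨m, rfl⟩ := Nat.exists_eq_add_of_le (Nat.lt_succ_iff.1 (Finset.mem_range.1 hk))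
    rw [coe_compRingHom_apply, mul_comp, C_comp, ← descPochhammer_mul (R := ℂ) (N + 1) k,
      mul_left_comm]
    congr 2
    rw [show N + 1 + (k + m) - (N + 1 + k) = m by omega, add_tsub_cancel_left]
    congr 2
    rw [show -(N : ℂ) + ((N + 1 + k : ℕ) : ℂ) = (k : ℂ) + 1 by push_cast; ring,
      show (N : ℂ) + 2 + k = ((N + 1 + k : ℕ) : ℂ) + 1 by push_cast; ring]
    have h1 := poch_natCast_add_one_mul k m
    have h2 := poch_natCast_add_one_mul (N + 1 + k) m
    have h3 := cast_choose_mul_factorial_mul_factorial k m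
    have h4 := cast_choose_mul_factorial_mul_factorial (N + 1 + k) m
    rw [← add_assoc (N + 1) k m]
    have f1 : (k.factorial : ℂ) ≠ 0 := by exact_mod_cast k.factorial_ne_zero
    have f2 : (m.factorial : ℂ) ≠ 0 := by exact_mod_cast m.factorial_ne_zero
    have f3 : ((N + 1 + k).factorial : ℂ) ≠ 0 := by
      exact_mod_cast (N + 1 + k).factorial_ne_zero
    have f4 := mul_ne_zero (mul_ne_zero f1 f2) f3
    -- After multiplication by k! m! (N+1+k)! both sides equal (k+m)! (N+1+k+m)!.
    refine mul_right_cancel₀ f4 ?_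
    linear_combination
      ((N + 1 + k + m).choose (N + 1 + k) : ℂ) * m.factorial * (N + 1 + k).factorial * h1
      + (k + m).factorial * h4
      - ((k + m).choose k : ℂ) * k.factorial * m.factorial * h2
      - (N + 1 + k + m).factorial * h3
  · intro k hk
    obtain ⟨m, rfl⟩ := Nat.exists_eq_add_of_le (Nat.lt_succ_iff.1 (Finset.mem_range.1 hk))
    rw [show -((k + m : ℕ) : ℂ) + k = -(m : ℂ) by push_cast; ring,
      poch_eq_zero_of_lt (show m < k + m + 1 + s - k by omega)]
    simp

theorem poch_natCast_add_two_ne_zero (N k : ℕ) : poch ((N : ℂ) + 2) k ≠ 0 := by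
  intro h
  have h1 := poch_natCast_add_one_mul (N + 1) k
  rw [show ((N + 1 : ℕ) : ℂ) + 1 = (N : ℂ) + 2 by push_cast; ring, h, zero_mul] at h1
  exact (Nat.factorial_ne_zero (N + 1 + k)) (by exact_mod_cast h1.symm)

theorem eval_krawtchouk_of_lt {p : ℂ} {N n : ℕ} (hp : p ≠ 0) (hp1 : p ≠ 1) (h : N < n) (x : ℂ) :
    (krawtchouk p N n).eval x = (krawtchouk p N (N + 1)).eval x *
      (meixner ((N : ℂ) + 2) (p / (p - 1)) (n - N - 1)).eval (x - (N : ℂ) - 1) := by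
  obtain ⟨s, rfl⟩ := Nat.exists_eq_add_of_le (Nat.succ_le_of_lt h)
  rw [krawtchouk_succ_self, meixner_eq hp hp1 (poch_natCast_add_two_ne_zero N),
    show N.succ = N + 1 from rfl, krawtchouk_factorization, eval_mul, eval_comp,
    show N + 1 + s - N - 1 = s by omega]
  congr 2
  simp
  ring

/-! ### The Meixner functional -/

theorem map_eq_zero_of_degree_lt (S : Polynomial.Sequence ℂ) (f : ℂ[X] →ₗ[ℂ] ℂ) {n : ℕ}
    (h : ∀ m < n, f (S m) = 0) {q : ℂ[X]} (hq : q.degree < n) : f q = 0 := by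
  rw [← mem_degreeLT, ← S.span_degreeLT fun i _ => by simp] at hq
  have : Submodule.span ℂ (S '' Set.Iio n) ≤ LinearMap.ker f := by
    rw [Submodule.span_le]
    rintro _ ⟨m, hm, rfl⟩
    exact h m hm
  exact this hq

/-- The falling factorials as a polynomial sequence. -/
def fallingSequence : Polynomial.Sequence ℂ := ⟨fun k => descPochhammer ℂ k, degree_descPochhammer⟩

/-- The falling factorials as a basis of the space of polynomials. -/
def fallingBasis : Module.Basis ℕ ℂ ℂ[X] := fallingSequence.basis fun i => by simp

theorem fallingBasis_apply (k : ℕ) : fallingBasis k = descPochhammer ℂ k :=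
  fallingSequence.basis_eq_self _ k

theorem linearMap_ext_descPochhammer {f g : ℂ[X] →ₗ[ℂ] ℂ}
    (h : ∀ k, f (descPochhammer ℂ k) = g (descPochhammer ℂ k)) : f = g :=
  fallingBasis.ext fun k => by simpa only [fallingBasis_apply] using h k

/-- The normalized Meixner functional, with falling factorial moments `(a)_k (-p)^k`. -/
def meixnerFunctional (a p : ℂ) : ℂ[X] →ₗ[ℂ] ℂ :=
  fallingBasis.constr ℂ fun k => poch a k * (-p) ^ k

theorem meixnerFunctional_descPochhammer (a p : ℂ) (k : ℕ) :
    meixnerFunctional a p (descPochhammer ℂ k) = poch a k * (-p) ^ k := by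
  rw [meixnerFunctional, ← fallingBasis_apply, Module.Basis.constr_basis]

/-- The expansion of r in falling factorials is finite and free of p, so the value is a polynomial
in p. -/
theorem differentiable_meixnerFunctional (a : ℂ) (r : ℂ[X]) :
    Differentiable ℂ fun p => meixnerFunctional a p r := by
  simp only [meixnerFunctional, Module.Basis.constr_apply, Finsupp.sum]
  fun_prop

/-- The rising factorials `(x + a)_m` as a polynomial sequence. -/
def risingSequence (a : ℂ) : Polynomial.Sequence ℂ :=
  ⟨fun m => (ascPochhammer ℂ m).comp (X + C a), fun m => by
    have h : ((ascPochhammer ℂ m).comp (X + C a)).natDegree = m := by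
      rw [natDegree_comp, ascPochhammer_natDegree, natDegree_X_add_C, mul_one]
    rw [degree_eq_natDegree, h]
    exact ((monic_ascPochhammer ℂ m).comp_X_add_C a).ne_zero⟩

theorem risingSequence_apply (a : ℂ) (m : ℕ) :
    risingSequence a m = (ascPochhammer ℂ m).comp (X + C a) := rfl

theorem risingSequence_succ (a : ℂ) (m : ℕ) :
    risingSequence a (m + 1) = risingSequence a m * (X + C (a + m)) := by
  simp [risingSequence_apply, ascPochhammer_succ_right, add_assoc]

/-- Splitting x+a+m = (x-k) + (a+k+m) yields the factor -p + 1 at each step in m. Rising factorials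
are the convenient test polynomials because these mixed moments are products. -/
theorem meixnerFunctional_descPochhammer_mul_rising (a p : ℂ) (k m : ℕ) :
    meixnerFunctional a p (descPochhammer ℂ k * risingSequence a m) =
      poch a (k + m) * (-p) ^ k * (1 - p) ^ m := by
  induction m generalizing k with
  | zero => simp [risingSequence_apply, meixnerFunctional_descPochhammer]
  | succ m ih =>
    have h : descPochhammer ℂ k * risingSequence a (m + 1) =
        descPochhammer ℂ (k + 1) * risingSequence a m +
          (a + k + m) • (descPochhammer ℂ k * risingSequence a m) := by
      rw [risingSequence_succ, descPochhammer_succ_right, smul_eq_C_mul]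
      simp
      ring
    rw [h, map_add, map_smul, ih, ih, show k + 1 + m = k + m + 1 by ring,
      show k + (m + 1) = k + m + 1 by ring, poch_succ, smul_eq_mul]
    push_cast
    ring

/-- Up to sign this is the n-th forward difference of a monic polynomial of degree m ≤ n. -/
theorem sum_choose_poch (a : ℂ) (n m : ℕ) (h : m ≤ n) :
    ∑ k ∈ Finset.range (n + 1), (-1 : ℂ) ^ k * n.choose k * poch (a + k) m =
      if m = n then (-1) ^ n * (n.factorial : ℂ) else 0 := by
  have key := fwdDiff_iter_eq_sum_shift (h := (1 : ℂ)) (ascPochhammer ℂ m).eval n a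
  have h1 : ∑ k ∈ Finset.range (n + 1), (-1 : ℂ) ^ k * n.choose k * poch (a + k) m =
      (-1) ^ n * (fwdDiff (1 : ℂ))^[n] (ascPochhammer ℂ m).eval a := by
    rw [key, Finset.mul_sum]
    refine Finset.sum_congr rfl fun k hk => ?_
    obtain ⟨j, rfl⟩ := Nat.exists_eq_add_of_le (Nat.lt_succ_iff.1 (Finset.mem_range.1 hk))
    have h2 : ((-1 : ℂ)) ^ j * (-1) ^ j = 1 := by rw [← mul_pow]; simp
    simp only [poch, zsmul_eq_mul, nsmul_eq_mul, mul_one, add_tsub_cancel_left]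
    push_cast
    rw [pow_add]
    linear_combination -(-1 : ℂ) ^ k * (k + j).choose k * (ascPochhammer ℂ m).eval (a + k) * h2
  rw [h1]
  split_ifs with hmn
  · subst hmn
    have h3 := Polynomial.fwdDiff_iter_degree_eq_factorial (ascPochhammer ℂ m)
    rw [ascPochhammer_natDegree, (monic_ascPochhammer ℂ m).leadingCoeff, one_smul] at h3
    rw [h3]
    rfl
  · have h3 := Polynomial.fwdDiff_iter_eq_zero_of_degree_lt (P := ascPochhammer ℂ m) (n := n)
      (by rw [ascPochhammer_natDegree]; omega)
    rw [h3]
    simp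

/-- Since (a)_{k+m} = (a)_k (a+k)_m and (a)_k (a+k)_{n-k} = (a)_n, the factor (a)_n leaves the sum
and an n-th difference remains. -/
theorem meixnerFunctional_generalKrawtchouk_mul_rising (a p : ℂ) {n m : ℕ} (h : m ≤ n) :
    meixnerFunctional a p (generalKrawtchouk a p n * risingSequence a m) =
      if m = n then p ^ n * (1 - p) ^ n * poch a n * ((-1) ^ n * (n.factorial : ℂ)) else 0 := by
  have h1 : meixnerFunctional a p (generalKrawtchouk a p n * risingSequence a m) =
      p ^ n * (1 - p) ^ m * poch a n *
        ∑ k ∈ Finset.range (n + 1), (-1 : ℂ) ^ k * n.choose k * poch (a + k) m := by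
    rw [generalKrawtchouk, Finset.sum_mul, map_sum, Finset.mul_sum]
    refine Finset.sum_congr rfl fun k hk => ?_
    obtain ⟨j, rfl⟩ := Nat.exists_eq_add_of_le (Nat.lt_succ_iff.1 (Finset.mem_range.1 hk))
    rw [mul_assoc, ← smul_eq_C_mul, map_smul, meixnerFunctional_descPochhammer_mul_rising,
      add_tsub_cancel_left, poch_add a k j, poch_add a k m, neg_pow, pow_add, smul_eq_mul]
    ring
  rw [h1, sum_choose_poch a n m h]
  split_ifs with hmn
  · rw [hmn]
  · simp

theorem meixnerFunctional_generalKrawtchouk_mul_of_degree_lt (a p : ℂ) {n : ℕ} {q : ℂ[X]}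
    (hq : q.degree < n) : meixnerFunctional a p (generalKrawtchouk a p n * q) = 0 := by
  refine map_eq_zero_of_degree_lt (risingSequence a)
    (meixnerFunctional a p ∘ₗ LinearMap.mulLeft ℂ (generalKrawtchouk a p n)) (fun m hm => ?_) hq
  rw [LinearMap.comp_apply, LinearMap.mulLeft_apply,
    meixnerFunctional_generalKrawtchouk_mul_rising a p hm.le, if_neg hm.ne]

theorem meixnerFunctional_generalKrawtchouk_mul_of_ne (a p : ℂ) {m n : ℕ} (h : m ≠ n) :
    meixnerFunctional a p (generalKrawtchouk a p m * generalKrawtchouk a p n) = 0 := by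
  rcases h.lt_or_gt with h | h
  · rw [mul_comm]
    exact meixnerFunctional_generalKrawtchouk_mul_of_degree_lt a p
      (by rw [degree_generalKrawtchouk]; exact_mod_cast h)
  · exact meixnerFunctional_generalKrawtchouk_mul_of_degree_lt a p
      (by rw [degree_generalKrawtchouk]; exact_mod_cast h)

/-- One factor may be replaced by the rising factorial, since their difference has degree below n.
-/
theorem meixnerFunctional_generalKrawtchouk_sq (a p : ℂ) (n : ℕ) :
    meixnerFunctional a p (generalKrawtchouk a p n * generalKrawtchouk a p n) =
      p ^ n * (1 - p) ^ n * poch a n * ((-1) ^ n * (n.factorial : ℂ)) := by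
  have hr : (risingSequence a n).Monic := (monic_ascPochhammer ℂ n).comp_X_add_C a
  have h : (generalKrawtchouk a p n - risingSequence a n).degree < n := by
    have hK := monic_generalKrawtchouk a p n
    have hd := degree_generalKrawtchouk a p n
    rw [← hd]
    exact degree_sub_lt_left (by rw [hd, (risingSequence a).degree_eq]) hK.ne_zero
      (by rw [hK.leadingCoeff, hr.leadingCoeff])
  have h1 := meixnerFunctional_generalKrawtchouk_mul_rising a p (le_refl n)
  have h2 := meixnerFunctional_generalKrawtchouk_mul_of_degree_lt a p h
  rw [mul_sub, map_sub, h1, if_pos rfl, sub_eq_zero] at h2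
  exact h2

/-! ### The discrete form -/

/-- The binomial functional `r ↦ ∑_{x=0}^N r(x) p^x (1-p)^{N-x} / (x! (N-x)!)`. -/
def discreteFunctional (p : ℂ) (N : ℕ) : ℂ[X] →ₗ[ℂ] ℂ :=
  ∑ x ∈ Finset.range (N + 1),
    (p ^ x * (1 - p) ^ (N - x) / ((x.factorial : ℂ) * ((N - x).factorial : ℂ))) •
      Polynomial.leval (x : ℂ)

theorem discreteFunctional_mul (p : ℂ) (N : ℕ) (r q : ℂ[X]) :
    discreteFunctional p N (r * q) = discreteForm p N r q := by
  rw [discreteFunctional, LinearMap.sum_apply]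
  refine Finset.sum_congr rfl fun x _ => ?_
  simp [Polynomial.leval]
  ring

/-- Comparison of falling factorial moments: for k ≤ N the sum starts at x = k and is a binomial
expansion of (p + (1-p))^{N-k}; for k > N both sides vanish. -/
theorem discreteFunctional_eq (p : ℂ) (N : ℕ) :
    discreteFunctional p N = (1 / (N.factorial : ℂ)) • meixnerFunctional (-(N : ℂ)) p := by
  refine linearMap_ext_descPochhammer fun k => ?_
  rw [LinearMap.smul_apply, meixnerFunctional_descPochhammer, discreteFunctional,
    LinearMap.sum_apply]
  simp only [LinearMap.smul_apply, Polynomial.leval_apply, descPochhammer_eval_eq_descFactorial,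
    smul_eq_mul]
  rcases lt_or_ge N k with hk | hk
  · rw [poch_eq_zero_of_lt hk, Finset.sum_eq_zero]
    · simp
    · intro x hx
      rw [Nat.descFactorial_eq_zero_iff_lt.2 (by have := Finset.mem_range.1 hx; omega)]
      simp
  obtain ⟨M, rfl⟩ := Nat.exists_eq_add_of_le hk
  have fne : ∀ j : ℕ, (j.factorial : ℂ) ≠ 0 := fun j => by exact_mod_cast j.factorial_ne_zero
  have e := cast_choose_mul_factorial_mul_factorial k M
  have hR : 1 / ((k + M).factorial : ℂ) * (poch (-((k + M : ℕ) : ℂ)) k * (-p) ^ k) =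
      p ^ k / M.factorial * (p + (1 - p)) ^ M := by
    have h2 : ((-1 : ℂ)) ^ k * (-1) ^ k = 1 := by rw [← mul_pow]; simp
    rw [poch_neg_eq, neg_pow p, add_sub_cancel, one_pow, ← e]
    have h1 : ((k + M).choose k : ℂ) ≠ 0 := by
      exact_mod_cast (Nat.choose_pos (Nat.le_add_right k M)).ne'
    have := fne k
    have := fne M
    field_simp
    linear_combination p ^ k * h2
  rw [hR, add_assoc, Finset.sum_range_add, Finset.sum_eq_zero, zero_add, add_pow, Finset.mul_sum]
  · refine Finset.sum_congr rfl fun y hy => ?_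
    obtain ⟨j, rfl⟩ := Nat.exists_eq_add_of_le (Nat.lt_succ_iff.1 (Finset.mem_range.1 hy))
    rw [show k + (y + j) - (k + y) = j by omega, add_tsub_cancel_left]
    have e1 := cast_choose_mul_factorial_mul_factorial y j
    have e2 : (y.factorial : ℂ) * ((k + y).descFactorial k : ℂ) = (k + y).factorial := by
      have := Nat.factorial_mul_descFactorial (Nat.le_add_right k y)
      rw [add_tsub_cancel_left] at this
      exact_mod_cast this
    rw [← e1, ← e2]
    have h1 : ((y + j).choose y : ℂ) ≠ 0 := by
      exact_mod_cast (Nat.choose_pos (Nat.le_add_right y j)).ne'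
    have h3 : ((k + y).descFactorial k : ℂ) ≠ 0 := by
      intro h0
      rw [h0, mul_zero] at e2
      exact fne _ e2.symm
    have := fne y
    have := fne j
    field_simp
    ring
  · intro x hx
    rw [Nat.descFactorial_eq_zero_iff_lt.2 (Finset.mem_range.1 hx)]
    simp

theorem discreteForm_eq (p : ℂ) (N : ℕ) (r q : ℂ[X]) :
    discreteForm p N r q = 1 / (N.factorial : ℂ) * meixnerFunctional (-(N : ℂ)) p (r * q) := by
  rw [← discreteFunctional_mul, discreteFunctional_eq]
  rfl

theorem discreteForm_krawtchouk_of_ne (p : ℂ) (N : ℕ) {m n : ℕ} (h : m ≠ n) :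
    discreteForm p N (krawtchouk p N m) (krawtchouk p N n) = 0 := by
  rw [discreteForm_eq, krawtchouk_eq, krawtchouk_eq,
    meixnerFunctional_generalKrawtchouk_mul_of_ne _ p h, mul_zero]

/-! ### The Sobolev form -/

/-- Uniqueness needs no positivity. If D = Q - P_n ≠ 0 has degree d < n, then B(D, P_d) = 0, while
orthogonality of P_d to lower degrees and symmetry make it the leading coefficient of D times B(P_d,
P_d) ≠ 0. -/
theorem isMOPS_of_bilin (B : ℂ[X] →ₗ[ℂ] ℂ[X] →ₗ[ℂ] ℂ) (hB : ∀ r q, B r q = B q r)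
    (P : Polynomial.Sequence ℂ) (hm : ∀ n, (P n).Monic)
    (ho : ∀ m n, m ≠ n → B (P m) (P n) = 0) (hr : ∀ n, B (P n) (P n) ≠ 0) :
    IsMOPS (fun r q => B r q) P where
  monic := hm
  natDegree_eq n := P.natDegree_eq n
  orthogonal := ho
  regular := hr
  unique n Q hQ hd hQ0 := by
    have hP : ∀ (n : ℕ) (q : ℂ[X]), q.degree < n → B (P n) q = 0 := fun n q hq =>
      map_eq_zero_of_degree_lt P (B (P n)) (fun m hm => ho n m hm.ne') hq
    let S : Polynomial.Sequence ℂ := ⟨fun m => X ^ m, fun m => degree_X_pow m⟩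
    have hQ1 : ∀ q : ℂ[X], q.degree < n → B Q q = 0 := fun q hq =>
      map_eq_zero_of_degree_lt S (B Q) hQ0 hq
    by_contra hne
    set D := Q - P n with hD
    have hD0 : D ≠ 0 := sub_ne_zero.2 hne
    have hQd : Q.degree = n := by rw [degree_eq_natDegree hQ.ne_zero, hd]
    have hDd : D.degree < n := by
      rw [← hQd]
      exact degree_sub_lt_left (by rw [hQd, P.degree_eq]) hQ.ne_zero
        (by rw [hQ.leadingCoeff, (hm n).leadingCoeff])
    have hdn : D.natDegree < n := by
      rwa [natDegree_lt_iff_degree_lt hD0]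
    have h1 : B D (P D.natDegree) = 0 := by
      rw [hD, map_sub, LinearMap.sub_apply, hP n, hQ1, sub_zero]
      all_goals rw [P.degree_eq]; exact_mod_cast hdn
    have h2 : (D - D.leadingCoeff • P D.natDegree).degree < D.natDegree := by
      have hl := leadingCoeff_ne_zero.2 hD0
      rw [← degree_eq_natDegree hD0, smul_eq_C_mul]
      refine degree_sub_lt_left ?_ hD0 ?_
      · rw [degree_C_mul hl, P.degree_eq, degree_eq_natDegree hD0]
      · rw [leadingCoeff_mul, (hm _).leadingCoeff, leadingCoeff_C, mul_one]
    have h3 := hP _ _ h2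
    rw [map_sub, map_smul, hB, h1, zero_sub, neg_eq_zero, smul_eq_mul] at h3
    exact mul_ne_zero (leadingCoeff_ne_zero.2 hD0) (hr _) h3

/-- The Sobolev form as a bilinear map. -/
def sobolevBilin (p : ℂ) (N : ℕ) (u : ℂ[X] →ₗ[ℂ] ℂ) : ℂ[X] →ₗ[ℂ] ℂ[X] →ₗ[ℂ] ℂ :=
  (LinearMap.mul ℂ ℂ[X]).compr₂ (discreteFunctional p N) +
    ((LinearMap.mul ℂ ℂ[X]).compr₂ u).compl₁₂ (deltaLin ^ (N + 1)) (deltaLin ^ (N + 1))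

theorem sobolevBilin_apply (p : ℂ) (N : ℕ) (u : ℂ[X] →ₗ[ℂ] ℂ) (r q : ℂ[X]) :
    sobolevBilin p N u r q = sobolevForm p N u r q := by
  simp [sobolevBilin, sobolevForm, deltaLin_pow_apply, discreteFunctional_mul]

/-- The entire continuation in `p` of the contour functional. -/
def continuedFunctional (p : ℂ) : ℂ[X] →ₗ[ℂ] ℂ :=
  (2 * Real.pi * Complex.I * (1 - p)) • meixnerFunctional 1 p

theorem differentiable_continuedFunctional (r : ℂ[X]) :
    Differentiable ℂ fun p => continuedFunctional p r := by
  have := differentiable_meixnerFunctional 1 r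
  simp only [continuedFunctional, LinearMap.smul_apply, smul_eq_mul]
  fun_prop

theorem delta_iterate_krawtchouk (p : ℂ) (N n : ℕ) :
    delta^[N + 1] (krawtchouk p N n) =
      (n.descFactorial (N + 1) : ℂ) • generalKrawtchouk 1 p (n - (N + 1)) := by
  rw [krawtchouk_eq, delta_iterate_generalKrawtchouk, smul_eq_C_mul]
  congr 2
  push_cast
  ring

theorem sobolevForm_krawtchouk_of_ne (p : ℂ) (N : ℕ) {m n : ℕ} (h : m ≠ n) :
    sobolevForm p N (continuedFunctional p) (krawtchouk p N m) (krawtchouk p N n) = 0 := by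
  rw [sobolevForm, discreteForm_krawtchouk_of_ne p N h, delta_iterate_krawtchouk,
    delta_iterate_krawtchouk, zero_add, smul_mul_smul_comm, map_smul, continuedFunctional,
    LinearMap.smul_apply]
  rcases lt_or_ge m (N + 1) with hm | hm
  · rw [Nat.descFactorial_eq_zero_iff_lt.2 hm]
    simp
  rcases lt_or_ge n (N + 1) with hn | hn
  · rw [Nat.descFactorial_eq_zero_iff_lt.2 hn]
    simp
  rw [meixnerFunctional_generalKrawtchouk_mul_of_ne 1 p (by omega)]
  simp

theorem sobolevForm_krawtchouk_self_ne_zero {p : ℂ} (hp : p ≠ 0) (hp1 : p ≠ 1) (N n : ℕ) :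
    sobolevForm p N (continuedFunctional p) (krawtchouk p N n) (krawtchouk p N n) ≠ 0 := by
  have hp1' : 1 - p ≠ 0 := sub_ne_zero.2 hp1.symm
  have fne : ∀ j : ℕ, (j.factorial : ℂ) ≠ 0 := fun j => by exact_mod_cast j.factorial_ne_zero
  have hs : ∀ j : ℕ, p ^ j * (1 - p) ^ j ≠ 0 := fun j => mul_ne_zero (pow_ne_zero _ hp)
    (pow_ne_zero _ hp1')
  have hf : ∀ j : ℕ, (-1) ^ j * (j.factorial : ℂ) ≠ 0 := fun j => mul_ne_zero
    (pow_ne_zero _ (by norm_num)) (fne j)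
  rw [sobolevForm, discreteForm_eq, delta_iterate_krawtchouk, smul_mul_smul_comm, map_smul,
    continuedFunctional, LinearMap.smul_apply, krawtchouk_eq,
    meixnerFunctional_generalKrawtchouk_sq, meixnerFunctional_generalKrawtchouk_sq]
  -- For n ≤ N the difference part vanishes and (-N)_n ≠ 0; for n > N the discrete part vanishes and
  -- (1)_{n-N-1} is a factorial.
  rcases lt_or_ge n (N + 1) with hn | hn
  · rw [Nat.descFactorial_eq_zero_iff_lt.2 hn]
    have := poch_neg_natCast_ne_zero (show n ≤ N by omega)
    simp only [Nat.cast_zero, mul_zero, zero_smul, add_zero]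
    exact mul_ne_zero (one_div_ne_zero (fne N)) (mul_ne_zero (mul_ne_zero (hs n) this) (hf n))
  · rw [poch_eq_zero_of_lt (show N < n by omega)]
    have h1 : poch 1 (n - (N + 1)) ≠ 0 := by
      rw [poch, ascPochhammer_eval_one]
      exact fne _
    have h2 : (n.descFactorial (N + 1) : ℂ) ≠ 0 := by
      rw [Nat.cast_ne_zero, ne_eq, Nat.descFactorial_eq_zero_iff_lt]
      omega
    have h3 : (2 * Real.pi * Complex.I * (1 - p) : ℂ) ≠ 0 :=
      mul_ne_zero Complex.two_pi_I_ne_zero hp1'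
    simp only [mul_zero, zero_mul, zero_add, smul_eq_mul]
    exact mul_ne_zero (mul_ne_zero h2 h2)
      (mul_ne_zero h3 (mul_ne_zero (mul_ne_zero (hs _) h1) (hf _)))

theorem isMOPS_krawtchouk {p : ℂ} (hp : p ≠ 0) (hp1 : p ≠ 1) (N : ℕ) :
    IsMOPS (sobolevForm p N (continuedFunctional p)) (krawtchouk p N) := by
  let P : Polynomial.Sequence ℂ := ⟨krawtchouk p N, fun n => by
    rw [krawtchouk_eq]; exact degree_generalKrawtchouk _ p n⟩
  have hP : ∀ n, P n = krawtchouk p N n := fun n => rfl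
  have h := isMOPS_of_bilin (sobolevBilin p N (continuedFunctional p))
    (fun r q => by rw [sobolevBilin_apply, sobolevBilin_apply, sobolevForm, sobolevForm,
      discreteForm_eq, discreteForm_eq, mul_comm r q, mul_comm (delta^[N + 1] r)]) P
    (fun n => by rw [hP, krawtchouk_eq]; exact monic_generalKrawtchouk _ p n)
    (fun m n hmn => by rw [sobolevBilin_apply]; exact sobolevForm_krawtchouk_of_ne p N hmn)
    (fun n => by rw [sobolevBilin_apply]; exact sobolevForm_krawtchouk_self_ne_zero hp hp1 N n)
  simpa only [sobolevBilin_apply] using h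

/-! ### The contour functional -/

theorem integrable_exp_neg_mul_abs {δ : ℝ} (hδ : 0 < δ) :
    MeasureTheory.Integrable fun t : ℝ => Real.exp (-δ * |t|) := by
  rw [← MeasureTheory.integrableOn_univ, ← Set.Iic_union_Ioi (a := (0 : ℝ)),
    MeasureTheory.integrableOn_union]
  constructor
  · refine (integrableOn_exp_mul_Iic hδ 0).congr_fun (fun t ht => ?_) measurableSet_Iic
    simp [abs_of_nonpos (Set.mem_Iic.1 ht)]
  · refine (integrableOn_exp_mul_Ioi (neg_lt_zero.2 hδ) 0).congr_fun (fun t ht => ?_)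
      measurableSet_Ioi
    simp [abs_of_pos (Set.mem_Ioi.1 ht)]

/-- Cauchy's theorem on rectangles of height 2T; the horizontal sides vanish as T → ∞. -/
theorem integral_vertical_eq_of_bound {h : ℂ → ℂ} {a b δ K : ℝ} (hδ : 0 < δ)
    (hd : DifferentiableOn ℂ h {z | z.re ∈ Set.uIcc a b})
    (hb : ∀ z : ℂ, z.re ∈ Set.uIcc a b → 1 ≤ |z.im| → ‖h z‖ ≤ K * Real.exp (-δ * |z.im|))
    (ha : MeasureTheory.Integrable fun t : ℝ => h (a + t * Complex.I))
    (hb' : MeasureTheory.Integrable fun t : ℝ => h (b + t * Complex.I)) :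
    ∫ t : ℝ, h (a + t * Complex.I) = ∫ t : ℝ, h (b + t * Complex.I) := by
  have rect : ∀ T : ℝ, (∫ x : ℝ in a..b, h (x + (-T : ℝ) * Complex.I)) -
      (∫ x : ℝ in a..b, h (x + T * Complex.I)) +
      Complex.I • (∫ y : ℝ in -T..T, h (b + y * Complex.I)) -
      Complex.I • (∫ y : ℝ in -T..T, h (a + y * Complex.I)) = 0 := by
    intro T
    have := Complex.integral_boundary_rect_eq_zero_of_differentiableOn h ⟨a, -T⟩ ⟨b, T⟩
      (hd.mono fun z hz => hz.1)
    simpa using this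
  have hor : ∀ ε : ℝ, |ε| = 1 → Filter.Tendsto
      (fun T : ℝ => ∫ x : ℝ in a..b, h (x + (ε * T : ℝ) * Complex.I)) Filter.atTop (nhds 0) := by
    intro ε hε
    have hlim : Filter.Tendsto (fun T : ℝ => K * Real.exp (-δ * T) * |b - a|) Filter.atTop
        (nhds 0) := by
      have h1 : Filter.Tendsto (fun T : ℝ => Real.exp (-δ * T)) Filter.atTop (nhds 0) :=
        Real.tendsto_exp_atBot.comp (Filter.tendsto_id.const_mul_atTop_of_neg (neg_lt_zero.2 hδ))
      simpa using (h1.const_mul K).mul_const |b - a|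
    refine squeeze_zero_norm' ?_ hlim
    filter_upwards [Filter.eventually_ge_atTop 1] with T hT
    refine intervalIntegral.norm_integral_le_of_norm_le_const fun x hx => ?_
    have hT' : |ε * T| = T := by rw [abs_mul, hε, one_mul, abs_of_nonneg (by linarith)]
    have := hb (x + (ε * T : ℝ) * Complex.I) (by simpa using Set.uIoc_subset_uIcc hx)
    simpa [hT', hT] using this
  have va := MeasureTheory.intervalIntegral_tendsto_integral ha Filter.tendsto_neg_atTop_atBot
    Filter.tendsto_id
  have vb := MeasureTheory.intervalIntegral_tendsto_integral hb' Filter.tendsto_neg_atTop_atBot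
    Filter.tendsto_id
  have h1 := hor 1 (by simp)
  have h2 := hor (-1) (by simp)
  have key := ((h2.sub h1).add (vb.const_smul Complex.I)).sub (va.const_smul Complex.I)
  have h0 := tendsto_nhds_unique key (tendsto_const_nhds.congr fun T => by
    simpa using (rect T).symm)
  rw [sub_zero, zero_add, sub_eq_zero] at h0
  exact (smul_right_injective ℂ Complex.I_ne_zero h0).symm

/-! ### Growth bounds and integrability on the strip -/

theorem exp_sub_exp_neg_le_norm_sin (z : ℂ) :
    |Real.exp z.im - Real.exp (-z.im)| / 2 ≤ ‖Complex.sin z‖ := by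
  have h := abs_norm_sub_norm_le (Complex.exp (-z * Complex.I)) (Complex.exp (z * Complex.I))
  rw [Complex.norm_exp, Complex.norm_exp] at h
  rw [Complex.sin, norm_div, norm_mul, Complex.norm_I, mul_one]
  simp at h ⊢
  linarith

theorem exp_abs_le_norm_sin {z : ℂ} (hz : 1 ≤ |z.im|) :
    Real.exp |z.im| / 4 ≤ ‖Complex.sin z‖ := by
  refine le_trans ?_ (exp_sub_exp_neg_le_norm_sin z)
  have h : |Real.exp z.im - Real.exp (-z.im)| = Real.exp |z.im| - Real.exp (-|z.im|) := by
    rcases le_total 0 z.im with h | h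
    · rw [abs_of_nonneg h, abs_of_nonneg]
      exact sub_nonneg.2 (Real.exp_le_exp.2 (by linarith))
    · rw [abs_of_nonpos h, abs_of_nonpos, neg_neg]
      · ring
      · exact sub_nonpos.2 (Real.exp_le_exp.2 (by linarith))
  rw [h]
  have h1 : 2 ≤ Real.exp |z.im| := by
    have := Real.add_one_le_exp |z.im|
    linarith
  have h2 : Real.exp (-|z.im|) ≤ 1 := Real.exp_le_one_iff.2 (by linarith)
  linarith

theorem exp_abs_le_cosh (t : ℝ) : Real.exp |t| / 2 ≤ Real.cosh t := by
  rw [← Real.cosh_abs, Real.cosh_eq]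
  have := Real.exp_pos (-|t|)
  linarith

theorem exists_norm_eval_le_exp (r : ℂ[X]) {ε : ℝ} (hε : 0 < ε) :
    ∃ K : ℝ, 0 ≤ K ∧ ∀ z : ℂ, |z.re| ≤ 1 / 2 → ‖r.eval z‖ ≤ K * Real.exp (ε * |z.im|) := by
  have h1 : ∀ {ε : ℝ}, 0 < ε → ∀ z : ℂ, 1 ≤ Real.exp (ε * |z.im|) := fun hε z =>
    Real.one_le_exp (by positivity)
  induction r using Polynomial.induction_on' generalizing ε with
  | add r q hr hq =>
    obtain ⟨K, hK, h⟩ := hr hε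
    obtain ⟨K', hK', h'⟩ := hq hε
    refine ⟨K + K', by positivity, fun z hz => ?_⟩
    rw [eval_add, add_mul]
    exact (norm_add_le _ _).trans (add_le_add (h z hz) (h' z hz))
  | monomial n c =>
    induction n generalizing ε with
    | zero =>
      refine ⟨‖c‖, norm_nonneg _, fun z _ => ?_⟩
      simpa using le_mul_of_one_le_right (norm_nonneg c) (h1 hε z)
    | succ n ih =>
      -- Half of the exponent is kept to absorb the additional factor z.
      obtain ⟨K, hK, h⟩ := ih (half_pos hε)
      refine ⟨K * (1 / 2 + 2 / ε), by positivity, fun z hz => ?_⟩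
      have h2 : ‖z‖ ≤ (1 / 2 + 2 / ε) * Real.exp (ε / 2 * |z.im|) := by
        have h3 := Complex.norm_le_abs_re_add_abs_im z
        have h4 := Real.add_one_le_exp (ε / 2 * |z.im|)
        have h5 : |z.im| ≤ 2 / ε * Real.exp (ε / 2 * |z.im|) := by
          calc |z.im| = 2 / ε * (ε / 2 * |z.im|) := by field_simp
            _ ≤ _ := by gcongr; linarith
        have h6 := h1 (half_pos hε) z
        rw [add_mul]
        linarith
      have h3 : Real.exp (ε * |z.im|) = Real.exp (ε / 2 * |z.im|) * Real.exp (ε / 2 * |z.im|) := by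
        rw [← Real.exp_add]
        congr 1
        ring
      have h4 := h z hz
      rw [eval_monomial] at h4 ⊢
      rw [h3, pow_succ, ← mul_assoc, norm_mul]
      calc _ ≤ K * Real.exp (ε / 2 * |z.im|) * ((1 / 2 + 2 / ε) * Real.exp (ε / 2 * |z.im|)) := by
            gcongr
        _ = _ := by ring

theorem exists_norm_eval_mul_exp_le (r : ℂ[X]) {l : ℂ} {δ : ℝ} (hδ : |l.im| + δ < Real.pi) :
    ∃ K : ℝ, 0 ≤ K ∧ ∀ z : ℂ, |z.re| ≤ 1 / 2 →
      ‖r.eval z * Complex.exp (l * z)‖ ≤ K * Real.exp ((Real.pi - δ) * |z.im|) := by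
  -- The exponential costs |Im l| in the growth rate; the polynomial gets what is left below π - δ.
  obtain ⟨K, hK, h⟩ := exists_norm_eval_le_exp r (ε := Real.pi - δ - |l.im|) (by linarith)
  refine ⟨K * Real.exp (|l.re| / 2), by positivity, fun z hz => ?_⟩
  have h1 : (l * z).re ≤ |l.re| / 2 + |l.im| * |z.im| := by
    rw [Complex.mul_re]
    have h2 : l.re * z.re ≤ |l.re| * (1 / 2) := by
      refine (le_abs_self _).trans ?_
      rw [abs_mul]
      gcongr
    have h3 : -(l.im * z.im) ≤ |l.im| * |z.im| := by
      rw [← abs_mul]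
      exact neg_le_abs _
    linarith
  rw [norm_mul, Complex.norm_exp]
  calc ‖r.eval z‖ * Real.exp (l * z).re
      ≤ K * Real.exp ((Real.pi - δ - |l.im|) * |z.im|) * Real.exp (|l.re| / 2 + |l.im| * |z.im|) := by
        gcongr
        exact h z hz
    _ = _ := by
        rw [mul_assoc, ← Real.exp_add, mul_assoc, ← Real.exp_add]
        congr 2
        ring

theorem sin_pi_mul_contourPt (t : ℝ) :
    Complex.sin (Real.pi * contourPt t) = -(Real.cosh (Real.pi * t) : ℂ) := by
  rw [contourPt, show (Real.pi : ℂ) * (-1 / 2 + t * Complex.I) =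
    (Real.pi * t : ℝ) * Complex.I - Real.pi / 2 by push_cast; ring, Complex.sin_sub_pi_div_two,
    Complex.cos_mul_I]
  push_cast
  rfl

theorem cosh_ne_zero' (t : ℝ) : (Real.cosh t : ℂ) ≠ 0 := by
  exact_mod_cast (Real.cosh_pos t).ne'

/-- The integrand of the contour integral, with `(p/(1-p))^z` written as `exp (l z)`. -/
def contourIntegrand (l : ℂ) (r : ℂ[X]) (t : ℝ) : ℂ :=
  r.eval (contourPt t) * Complex.exp (l * contourPt t) * (Real.pi / Real.cosh (Real.pi * t) : ℂ)

theorem integrable_contourIntegrand {l : ℂ} (hl : |l.im| < Real.pi) (r : ℂ[X]) :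
    MeasureTheory.Integrable (contourIntegrand l r) := by
  obtain ⟨δ, hδ0, hδ⟩ : ∃ δ : ℝ, 0 < δ ∧ |l.im| + δ < Real.pi :=
    ⟨(Real.pi - |l.im|) / 2, by linarith, by linarith⟩
  obtain ⟨K, hK, h⟩ := exists_norm_eval_mul_exp_le r hδ
  refine ((integrable_exp_neg_mul_abs hδ0).const_mul (K * (2 * Real.pi))).mono' ?_ ?_
  · refine Continuous.aestronglyMeasurable ?_
    unfold contourIntegrand contourPt
    have : ∀ t : ℝ, (Real.cosh (Real.pi * t) : ℂ) ≠ 0 := fun t => cosh_ne_zero' _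
    have hc : Continuous fun t : ℝ => (Real.cosh (Real.pi * t) : ℂ) :=
      Complex.continuous_ofReal.comp (Real.continuous_cosh.comp (by fun_prop))
    fun_prop (disch := assumption)
  · refine Filter.Eventually.of_forall fun t => ?_
    have h1 := h (contourPt t) (by simp [contourPt]; norm_num)
    have him : (contourPt t).im = t := by simp [contourPt]
    rw [him] at h1
    have h2 : ‖(Real.pi / Real.cosh (Real.pi * t) : ℂ)‖ ≤ 2 * Real.pi * Real.exp (-Real.pi * |t|) := by
      rw [norm_div, Complex.norm_real, Complex.norm_real, Real.norm_of_nonneg Real.pi_pos.le,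
        Real.norm_of_nonneg (Real.cosh_pos _).le, div_le_iff₀ (Real.cosh_pos _)]
      have h3 := exp_abs_le_cosh (Real.pi * t)
      rw [abs_mul, abs_of_pos Real.pi_pos] at h3
      calc Real.pi = 2 * Real.pi * Real.exp (-Real.pi * |t|) * (Real.exp (Real.pi * |t|) / 2) := by
            rw [show 2 * Real.pi * Real.exp (-Real.pi * |t|) * (Real.exp (Real.pi * |t|) / 2) =
              Real.pi * (Real.exp (-Real.pi * |t|) * Real.exp (Real.pi * |t|)) by ring,
              ← Real.exp_add]
            simp
        _ ≤ _ := by gcongr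
    rw [contourIntegrand, norm_mul]
    calc _ ≤ K * Real.exp ((Real.pi - δ) * |t|) * (2 * Real.pi * Real.exp (-Real.pi * |t|)) := by
          gcongr
      _ = K * (2 * Real.pi) * (Real.exp ((Real.pi - δ) * |t|) * Real.exp (-Real.pi * |t|)) := by
          ring
      _ = _ := by
          rw [← Real.exp_add]
          congr 2
          ring

/-- An antiderivative is arctan(sinh(πt)). -/
theorem integral_pi_div_cosh : ∫ t : ℝ, Real.pi / Real.cosh (Real.pi * t) = Real.pi := by
  have hint : MeasureTheory.Integrable fun t : ℝ => Real.pi / Real.cosh (Real.pi * t) := by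
    have := (integrable_contourIntegrand (l := 0) (by simpa using Real.pi_pos) 1).re
    refine this.congr (Filter.Eventually.of_forall fun t => ?_)
    simp only [contourIntegrand, eval_one, zero_mul, Complex.exp_zero, one_mul]
    rw [← Complex.ofReal_div]
    exact Complex.ofReal_re _
  have hd : ∀ t : ℝ, HasDerivAt (fun t => Real.arctan (Real.sinh (Real.pi * t)))
      (Real.pi / Real.cosh (Real.pi * t)) t := by
    intro t
    have h1 : HasDerivAt (fun t : ℝ => Real.pi * t) Real.pi t := by
      simpa using (hasDerivAt_id t).const_mul Real.pi
    convert h1.sinh.arctan using 1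
    have := (Real.cosh_pos (Real.pi * t)).ne'
    rw [← Real.cosh_sq']
    field_simp
  have hs : Filter.Tendsto Real.sinh Filter.atTop Filter.atTop :=
    Real.sinhOrderIso.tendsto_atTop
  have hs' : Filter.Tendsto Real.sinh Filter.atBot Filter.atBot :=
    Real.sinhOrderIso.tendsto_atBot
  have htop : Filter.Tendsto (fun t => Real.arctan (Real.sinh (Real.pi * t))) Filter.atTop
      (nhds (Real.pi / 2)) :=
    (Real.tendsto_arctan_atTop.mono_right nhdsWithin_le_nhds).comp
      (hs.comp (Filter.tendsto_id.const_mul_atTop Real.pi_pos))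
  have hbot : Filter.Tendsto (fun t => Real.arctan (Real.sinh (Real.pi * t))) Filter.atBot
      (nhds (-(Real.pi / 2))) :=
    (Real.tendsto_arctan_atBot.mono_right nhdsWithin_le_nhds).comp
      (hs'.comp (Filter.tendsto_id.const_mul_atBot Real.pi_pos))
  rw [MeasureTheory.integral_of_hasDerivAt_of_tendsto hd hint hbot htop]
  ring

theorem integral_contourIntegrand_C_zero (c : ℂ) :
    ∫ t : ℝ, contourIntegrand 0 (C c) t = c * Real.pi := by
  have h : contourIntegrand 0 (C c) =
      fun t => c * ((Real.pi / Real.cosh (Real.pi * t) : ℝ) : ℂ) := by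
    ext t
    simp [contourIntegrand]
  rw [h, MeasureTheory.integral_const_mul, integral_complex_ofReal, integral_pi_div_cosh]

/-! ### Moving the contour across the pole at 0 -/

theorem sin_pi_mul_ne_zero {z : ℂ} (hz : z ≠ 0) (hr : |z.re| ≤ 1 / 2) :
    Complex.sin (Real.pi * z) ≠ 0 := by
  rw [Ne, Complex.sin_eq_zero_iff]
  rintro ⟨k, hk⟩
  have hpi : (Real.pi : ℂ) ≠ 0 := by exact_mod_cast Real.pi_ne_zero
  have hzk : z = k := mul_left_cancel₀ hpi (by rw [hk, mul_comm])
  rw [hzk, Complex.intCast_re] at hr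
  have : k = 0 := by
    rw [← Int.abs_lt_one_iff]
    have : |(k : ℝ)| < 1 := by linarith
    exact_mod_cast this
  exact hz (by rw [hzk, this, Int.cast_zero])

theorem dslope_sin_pi_mul_ne_zero {z : ℂ} (hr : |z.re| ≤ 1 / 2) :
    dslope (fun z : ℂ => Complex.sin (Real.pi * z)) 0 z ≠ 0 := by
  rcases eq_or_ne z 0 with rfl | hz
  · have h : HasDerivAt (fun z : ℂ => Complex.sin (Real.pi * z)) Real.pi 0 := by
      have h1 : HasDerivAt (fun z : ℂ => (Real.pi : ℂ) * z) Real.pi 0 := by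
        simpa using (hasDerivAt_id (0 : ℂ)).const_mul (Real.pi : ℂ)
      simpa using h1.csin
    rw [dslope_same, h.deriv]
    exact_mod_cast Real.pi_ne_zero
  · rw [dslope_of_ne _ hz, slope_def_field]
    simpa using ⟨sin_pi_mul_ne_zero hz hr, hz⟩

/-- The integral is compared on Re z = -1/2 and Re z = 1/2. Subtracting r(0) from the numerator
removes the pole at 0, so Cauchy's theorem suffices; the subtracted constant contributes π r(0) on
each line, in place of a residue. -/
theorem integral_contourIntegrand_add_shift {l : ℂ} (hl : |l.im| < Real.pi) (r : ℂ[X]) :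
    (∫ t : ℝ, contourIntegrand l r t) +
      Complex.exp l * ∫ t : ℝ, contourIntegrand l (r.comp (X + 1)) t =
        2 * Real.pi * r.eval 0 := by
  set g : ℂ → ℂ := fun z => r.eval z * Complex.exp (l * z) - r.eval 0 with hg
  set S : ℂ → ℂ := fun z => Complex.sin (Real.pi * z) with hS
  -- This is g/S with the removable singularity at 0 filled in: both vanish at 0, and S has a simple
  -- zero there.
  set h : ℂ → ℂ := fun z => dslope g 0 z / dslope S 0 z with hh
  have hg0 : g 0 = 0 := by simp [hg]
  have hS0 : S 0 = 0 := by simp [hS]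
  have hne : ∀ z : ℂ, z ≠ 0 → h z = g z / S z := by
    intro z hz
    simp only [hh]
    rw [dslope_of_ne _ hz, dslope_of_ne _ hz, slope_def_field, slope_def_field, hg0, hS0, sub_zero,
      sub_zero, sub_zero, div_div_div_cancel_right₀ hz]
  have hgd : Differentiable ℂ g := by
    have := r.differentiable
    fun_prop
  have hSd : Differentiable ℂ S := by fun_prop
  have dsl : ∀ f : ℂ → ℂ, Differentiable ℂ f → Differentiable ℂ (dslope f 0) := fun f hf => by
    rw [← differentiableOn_univ] at hf ⊢
    exact (Complex.differentiableOn_dslope Filter.univ_mem).2 hf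
  have hstrip : ∀ z : ℂ, z.re ∈ Set.uIcc (-1 / 2 : ℝ) (1 / 2) → |z.re| ≤ 1 / 2 := by
    intro z hz
    rw [Set.uIcc_of_le (by norm_num)] at hz
    exact abs_le.2 ⟨by linarith [hz.1], hz.2⟩
  have hd : DifferentiableOn ℂ h {z | z.re ∈ Set.uIcc (-1 / 2 : ℝ) (1 / 2)} := fun z hz =>
    ((dsl g hgd z).div (dsl S hSd z)
      (dslope_sin_pi_mul_ne_zero (hstrip z hz))).differentiableWithinAt
  obtain ⟨δ, hδ0, hδ⟩ : ∃ δ : ℝ, 0 < δ ∧ |l.im| + δ < Real.pi :=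
    ⟨(Real.pi - |l.im|) / 2, by linarith, by linarith⟩
  obtain ⟨K, hK, hKb⟩ := exists_norm_eval_mul_exp_le r hδ
  have hb : ∀ z : ℂ, z.re ∈ Set.uIcc (-1 / 2 : ℝ) (1 / 2) → 1 ≤ |z.im| →
      ‖h z‖ ≤ 4 * (K + ‖r.eval 0‖) * Real.exp (-δ * |z.im|) := by
    intro z hz hz1
    have hz0 : z ≠ 0 := by
      rintro rfl
      norm_num at hz1
    have hgz : ‖g z‖ ≤ (K + ‖r.eval 0‖) * Real.exp ((Real.pi - δ) * |z.im|) := by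
      have h1 : 1 ≤ Real.exp ((Real.pi - δ) * |z.im|) :=
        Real.one_le_exp (mul_nonneg (by linarith [abs_nonneg l.im]) (abs_nonneg _))
      refine (norm_sub_le _ _).trans ?_
      rw [add_mul]
      exact add_le_add (hKb z (hstrip z hz)) (le_mul_of_one_le_right (norm_nonneg _) h1)
    have him : |((Real.pi : ℂ) * z).im| = Real.pi * |z.im| := by
      simp [abs_mul, abs_of_pos Real.pi_pos]
    have hSz : Real.exp (Real.pi * |z.im|) / 4 ≤ ‖S z‖ := by
      rw [← him]
      refine exp_abs_le_norm_sin ?_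
      rw [him]
      nlinarith [Real.pi_gt_three]
    have hSpos : 0 < ‖S z‖ := lt_of_lt_of_le (by positivity) hSz
    rw [hne z hz0, norm_div, div_le_iff₀ hSpos]
    calc ‖g z‖ ≤ (K + ‖r.eval 0‖) * Real.exp ((Real.pi - δ) * |z.im|) := hgz
      _ = 4 * (K + ‖r.eval 0‖) * Real.exp (-δ * |z.im|) * (Real.exp (Real.pi * |z.im|) / 4) := by
        rw [show (Real.pi - δ) * |z.im| = -δ * |z.im| + Real.pi * |z.im| by ring, Real.exp_add]
        ring
      _ ≤ _ := by gcongr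
  have hpi : (Real.pi : ℂ) ≠ 0 := by exact_mod_cast Real.pi_ne_zero
  have hleft : (fun t : ℝ => h (((-1 / 2 : ℝ) : ℂ) + t * Complex.I)) = fun t =>
      (1 / Real.pi : ℂ) * (contourIntegrand 0 (C (r.eval 0)) t - contourIntegrand l r t) := by
    ext t
    have hpt : ((-1 / 2 : ℝ) : ℂ) + t * Complex.I = contourPt t := by
      rw [contourPt]
      push_cast
      rfl
    have h0 : contourPt t ≠ 0 := fun h0 => by
      have := congrArg Complex.re h0
      norm_num [contourPt] at this
    have hcosh := cosh_ne_zero' (Real.pi * t)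
    rw [hpt, hne _ h0]
    simp only [hg, hS, sin_pi_mul_contourPt, contourIntegrand, eval_C, zero_mul, Complex.exp_zero]
    field_simp
    ring
  have hright : (fun t : ℝ => h (((1 / 2 : ℝ) : ℂ) + t * Complex.I)) = fun t =>
      (1 / Real.pi : ℂ) * (Complex.exp l * contourIntegrand l (r.comp (X + 1)) t -
        contourIntegrand 0 (C (r.eval 0)) t) := by
    ext t
    have hpt : ((1 / 2 : ℝ) : ℂ) + t * Complex.I = contourPt t + 1 := by
      rw [contourPt]
      push_cast
      ring
    have h0 : contourPt t + 1 ≠ 0 := fun h0 => by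
      have := congrArg Complex.re h0
      norm_num [contourPt] at this
    have hcosh := cosh_ne_zero' (Real.pi * t)
    have hsin : Complex.sin (Real.pi * (contourPt t + 1)) = (Real.cosh (Real.pi * t) : ℂ) := by
      rw [mul_add, mul_one, Complex.sin_add_pi, sin_pi_mul_contourPt, neg_neg]
    rw [hpt, hne _ h0]
    simp only [hg, hS, hsin, contourIntegrand, eval_C, zero_mul, Complex.exp_zero, eval_comp,
      eval_add, eval_X, eval_one]
    rw [mul_add, mul_one, Complex.exp_add]
    field_simp
  have i1 := integrable_contourIntegrand hl r
  have i2 := integrable_contourIntegrand hl (r.comp (X + 1))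
  have i3 := integrable_contourIntegrand (l := 0) (by simpa using Real.pi_pos) (C (r.eval 0))
  have key := integral_vertical_eq_of_bound hδ0 hd hb
    (by rw [hleft]; exact (i3.sub i1).const_mul _)
    (by rw [hright]; exact ((i2.const_mul _).sub i3).const_mul _)
  rw [hleft, hright, MeasureTheory.integral_const_mul, MeasureTheory.integral_const_mul,
    MeasureTheory.integral_sub i3 i1, MeasureTheory.integral_sub (i2.const_mul _) i3,
    MeasureTheory.integral_const_mul, integral_contourIntegrand_C_zero] at key
  have key' := mul_left_cancel₀ (one_div_ne_zero hpi) key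
  linear_combination -key'

/-! ### Identification of the contour functional -/

theorem one_sub_ne_zero_of_mem {p : ℂ} (hp : p ∈ convergenceDomain) : 1 - p ≠ 0 := by
  intro h
  have : p = 1 := (sub_eq_zero.1 h).symm
  subst this
  norm_num [convergenceDomain] at hp

theorem ne_zero_of_mem {p : ℂ} (hp : p ∈ convergenceDomain) : p ≠ 0 := by
  rintro rfl
  norm_num [convergenceDomain] at hp

/-- If p/(1-p) = x ≤ 0, then p = x/(1+x) is real and outside (0,1). The strict bound is what makes
the integrand decay. -/
theorem abs_im_log_lt_pi {p : ℂ} (hp : p ∈ convergenceDomain) :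
    |(Complex.log (p / (1 - p))).im| < Real.pi := by
  have h1 := one_sub_ne_zero_of_mem hp
  have hmem : p / (1 - p) ∈ Complex.slitPlane := by
    by_contra hs
    rw [Complex.mem_slitPlane_iff, not_or, not_lt, not_not] at hs
    obtain ⟨x, hx⟩ : ∃ x : ℝ, p / (1 - p) = x := ⟨_, Complex.ext rfl (by simpa using hs.2)⟩
    have hx0 : x ≤ 0 := by simpa [hx] using hs.1
    have hp1 : p * (1 + x) = x := by
      rw [div_eq_iff h1] at hx
      linear_combination hx
    have hx1 : (1 + x : ℝ) ≠ 0 := by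
      intro h
      have hxm : x = -1 := by linarith
      rw [hxm] at hp1
      norm_num at hp1
    have hpx : p = ((x / (1 + x) : ℝ) : ℂ) := by
      have : (1 + x : ℂ) ≠ 0 := by exact_mod_cast hx1
      push_cast
      rw [eq_div_iff this, hp1]
    rw [hpx, convergenceDomain] at hp
    simp only [Set.mem_ofPred_eq, Complex.ofReal_im, Complex.ofReal_re, ne_eq, not_true_eq_false,
      false_or] at hp
    rcases lt_or_gt_of_ne hx1 with h | h
    · have := hp.2
      rw [div_lt_one_of_neg h] at this
      linarith
    · exact absurd hp.1 (not_lt.2 (div_nonpos_of_nonpos_of_nonneg hx0 h.le))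
  rw [Complex.log_im]
  refine abs_lt.2 ⟨Complex.neg_pi_lt_arg _, lt_of_le_of_ne (Complex.arg_le_pi _) ?_⟩
  exact Complex.slitPlane_arg_ne_pi hmem

/-- By reflection Γ(-z)Γ(1+z) = -π/sin(πz), which is π/cosh(πt) on the contour. -/
theorem eval_mul_weight_eq {p : ℂ} (hp : p ∈ convergenceDomain) (r : ℂ[X]) (t : ℝ) :
    r.eval (contourPt t) * weight p (contourPt t) * Complex.I =
      contourIntegrand (Complex.log (p / (1 - p))) r t * Complex.I := by
  have h1 := Complex.Gamma_mul_Gamma_one_sub (-contourPt t)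
  rw [sub_neg_eq_add, mul_neg, Complex.sin_neg, sin_pi_mul_contourPt, neg_neg] at h1
  rw [weight, h1, Complex.cpow_def_of_ne_zero
    (div_ne_zero (ne_zero_of_mem hp) (one_sub_ne_zero_of_mem hp)), contourIntegrand]
  ring

theorem integrable_eval_mul_weight {p : ℂ} (hp : p ∈ convergenceDomain) (r : ℂ[X]) :
    MeasureTheory.Integrable fun t : ℝ =>
      r.eval (contourPt t) * weight p (contourPt t) * Complex.I := by
  simp only [eval_mul_weight_eq hp]
  exact (integrable_contourIntegrand (abs_im_log_lt_pi hp) r).mul_const _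

/-- The contour functional as a linear map. -/
def contourLin {p : ℂ} (hp : p ∈ convergenceDomain) : ℂ[X] →ₗ[ℂ] ℂ where
  toFun := contourFunctional p
  map_add' r q := by
    rw [contourFunctional, contourFunctional, contourFunctional, ← MeasureTheory.integral_add
      (integrable_eval_mul_weight hp r) (integrable_eval_mul_weight hp q)]
    congr 1
    ext t
    rw [eval_add]
    ring
  map_smul' c r := by
    rw [contourFunctional, contourFunctional, RingHom.id_apply, smul_eq_mul,
      ← MeasureTheory.integral_const_mul]
    congr 1
    ext t
    rw [eval_smul, smul_eq_mul]
    ring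

theorem contourLin_apply {p : ℂ} (hp : p ∈ convergenceDomain) (r : ℂ[X]) :
    contourLin hp r = contourFunctional p r := rfl

theorem contourFunctional_eq_integral {p : ℂ} (hp : p ∈ convergenceDomain) (r : ℂ[X]) :
    contourFunctional p r =
      (∫ t : ℝ, contourIntegrand (Complex.log (p / (1 - p))) r t) * Complex.I := by
  simp only [contourFunctional, eval_mul_weight_eq hp, MeasureTheory.integral_mul_const]

theorem contourLin_recurrence {p : ℂ} (hp : p ∈ convergenceDomain) (r : ℂ[X]) :
    contourLin hp r =
      2 * Real.pi * Complex.I * (1 - p) * r.eval 0 - p * contourLin hp (delta r) := by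
  have h1 := one_sub_ne_zero_of_mem hp
  have h := integral_contourIntegrand_add_shift (abs_im_log_lt_pi hp) r
  rw [Complex.exp_log (div_ne_zero (ne_zero_of_mem hp) h1)] at h
  rw [delta, map_sub, contourLin_apply, contourLin_apply, contourFunctional_eq_integral hp,
    contourFunctional_eq_integral hp]
  field_simp at h
  linear_combination Complex.I * h

/-- On falling factorials of positive order r(0) = 0, so the recurrence multiplies the moment by
-p(k+1), the ratio of consecutive (1)_k (-p)^k. -/
theorem contourLin_eq {p : ℂ} (hp : p ∈ convergenceDomain) :
    contourLin hp = continuedFunctional p := by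
  refine linearMap_ext_descPochhammer fun k => ?_
  rw [continuedFunctional, LinearMap.smul_apply, meixnerFunctional_descPochhammer, smul_eq_mul]
  induction k with
  | zero =>
    rw [contourLin_recurrence]
    simp [delta, poch_zero]
  | succ k ih =>
    rw [contourLin_recurrence, delta_descPochhammer, ← smul_eq_C_mul, map_smul, ih,
      descPochhammer_ne_zero_eval_zero ℂ k.succ_ne_zero, poch_succ, smul_eq_mul]
    ring

theorem continuedFunctional_eq_contourFunctional {p : ℂ} (hp : p ∈ convergenceDomain) (r : ℂ[X]) :
    continuedFunctional p r = contourFunctional p r := by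
  rw [← contourLin_eq hp, contourLin_apply]

theorem isMOPS_krawtchouk_contour {p : ℂ} (hp : p ∈ convergenceDomain) (N : ℕ) :
    IsMOPS (sobolevForm p N (contourFunctional p)) (krawtchouk p N) := by
  have h := isMOPS_krawtchouk (ne_zero_of_mem hp)
    (fun h => one_sub_ne_zero_of_mem hp (by rw [h, sub_self])) N
  rwa [show (⇑(continuedFunctional p) : ℂ[X] → ℂ) = contourFunctional p from
    funext (continuedFunctional_eq_contourFunctional hp)] at h

end KrawtchoukSobolev

end

theorem mainTheorem7 :
    -- factorization, for all complex `p ≠ 0, 1` and all degrees `n > N`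
    (∀ (p : ℂ) (N n : ℕ), p ≠ 0 → p ≠ 1 → N < n → ∀ x : ℂ,
      (KrawtchoukSobolev.krawtchouk p N n).eval x =
        (KrawtchoukSobolev.krawtchouk p N (N + 1)).eval x *
          (KrawtchoukSobolev.meixner ((N : ℂ) + 2) (p / (p - 1)) (n - N - 1)).eval
            (x - (N : ℂ) - 1)) ∧
    -- discrete orthogonality, for all complex `p ≠ 0, 1`
    (∀ (p : ℂ) (N : ℕ), p ≠ 0 → p ≠ 1 → ∀ m n : ℕ, m ≠ n →
      KrawtchoukSobolev.discreteForm p N (KrawtchoukSobolev.krawtchouk p N m)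
        (KrawtchoukSobolev.krawtchouk p N n) = 0) ∧
    -- absolute convergence of the contour integral
    (∀ p ∈ KrawtchoukSobolev.convergenceDomain, ∀ r : Polynomial ℂ,
      MeasureTheory.Integrable (fun t : ℝ =>
        r.eval (KrawtchoukSobolev.contourPt t) *
          KrawtchoukSobolev.weight p (KrawtchoukSobolev.contourPt t) * Complex.I)) ∧
    -- `Δ`-Sobolev orthogonality, with the contour integral
    (∀ p ∈ KrawtchoukSobolev.convergenceDomain, ∀ N : ℕ,
      KrawtchoukSobolev.IsMOPS
        (KrawtchoukSobolev.sobolevForm p N (KrawtchoukSobolev.contourFunctional p))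
        (KrawtchoukSobolev.krawtchouk p N)) ∧
    -- `Δ`-Sobolev orthogonality for all complex `p ≠ 0, 1`, with the analytic continuation
    -- of the contour integral in `p`
    (∃ L : ℂ → (Polynomial ℂ →ₗ[ℂ] ℂ),
      (∀ r : Polynomial ℂ, Differentiable ℂ (fun p => L p r)) ∧
      (∀ p ∈ KrawtchoukSobolev.convergenceDomain, ∀ r : Polynomial ℂ,
        L p r = KrawtchoukSobolev.contourFunctional p r) ∧
      (∀ (p : ℂ) (N : ℕ), p ≠ 0 → p ≠ 1 →
        KrawtchoukSobolev.IsMOPS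
          (KrawtchoukSobolev.sobolevForm p N (L p))
          (KrawtchoukSobolev.krawtchouk p N))) := by
  refine ⟨fun p N n hp hp1 hn x => KrawtchoukSobolev.eval_krawtchouk_of_lt hp hp1 hn x,
    fun p N _ _ m n hmn => KrawtchoukSobolev.discreteForm_krawtchouk_of_ne p N hmn,
    fun p hp r => KrawtchoukSobolev.integrable_eval_mul_weight hp r,
    fun p hp N => KrawtchoukSobolev.isMOPS_krawtchouk_contour hp N,
    KrawtchoukSobolev.continuedFunctional, KrawtchoukSobolev.differentiable_continuedFunctional,
    fun p hp r => KrawtchoukSobolev.continuedFunctional_eq_contourFunctional hp r,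
    fun p N hp hp1 => KrawtchoukSobolev.isMOPS_krawtchouk hp hp1 N⟩
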